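/- (First logarithmic summation formulas.) Let $B_m$ denote the Bernoulli numbers, $\frac{x}{e^x-1}=\sum_{m\ge 0}\frac{B_m}{m!}x^m$, let $S_k^{(1)}(l)$ denote the (signed) Stirling numbers of the first kind, defined by $x(x+1)\cdots(x+k-1)=(-1)^k\sum_{l=0}^k(-1)^lS_k^{(1)}(l)x^l$, let $\zeta$ be the Riemann zeta function, and read $0\log 0$ as $0$. Then for every natural number $n\ge 1$ the two series below converge absolutely and $$\sum_{k=0}^{n}k\log k=\tfrac12n^2\log n-\tfrac14n^2+\tfrac12n\log n+\tfrac1{12}\log n+\tfrac1{12}-\zeta'(-1)+\sum_{k=1}^{\infty}\frac{c_k}{(n+1)(n+2)\cdots(n+k)},$$ where $c_k=(-1)^{k+1}\sum_{l=1}^{k}\frac{(-1)^l}{l(l+1)(l+2)}B_{l+2}S_k^{(1)}(l)$, and $$\sum_{k=0}^{n}k\log k=\tfrac12n^2\log n-\tfrac14n^2+\tfrac12n\log n+\tfrac1{12}\log n+\tfrac1{12}-\zeta'(-1)+\sum_{k=1}^{\infty}\frac{d_k}{n(n+1)(n+2)\cdots(n+k)},$$ where $d_k=(-1)^{k+1}\sum_{l=1}^{k}\frac{(-1)^l}{(l+1)(l+2)(l+3)}B_{l+3}S_k^{(1)}(l)$.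 The first coefficients are $c_1=0$, $c_2=\frac1{720}$, $c_3=\frac1{240}$, $c_4=\frac{19}{1260}$, $c_5=\frac{17}{252}$ and $d_1=\frac1{720}$, $d_2=\frac1{720}$, $d_3=\frac{13}{5040}$, $d_4=\frac1{140}$. -/

import Mathlib

/-- The (signed) Stirling numbers of the first kind `S_k^{(1)}(l)`; Mathlib's
`Nat.stirlingFirst` is the unsigned version. -/
def signedStirlingFirst (k l : ℕ) : ℤ :=
  (-1) ^ (k + l) * (Nat.stirlingFirst k l : ℤ)

theorem ascPochhammer_eval_eq_sum_stirlingFirst {R : Type*} [CommRing R] (k : ℕ) (x : R) :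
    (ascPochhammer R k).eval x =
      ∑ l ∈ Finset.range (k + 1), (Nat.stirlingFirst k l : R) * x ^ l := by
  induction k with
  | zero => simp
  | succ k ih =>
    rw [ascPochhammer_succ_eval, ih, Finset.sum_range_succ' _ (k + 1)]
    simp only [Nat.stirlingFirst_succ_succ, Nat.stirlingFirst_succ_zero, Nat.cast_add,
      Nat.cast_mul, add_mul, Finset.sum_add_distrib, Nat.cast_zero, zero_mul, add_zero]
    rw [mul_add, add_comm]
    congr 1
    · have h1 := Finset.sum_range_succ'
        (fun l => (k : R) * (Nat.stirlingFirst k l : R) * x ^ l) (k + 1)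
      rw [Finset.sum_range_succ,
        Nat.stirlingFirst_eq_zero_of_lt (Nat.lt_succ_self k)] at h1
      have h0 : (k : R) * (Nat.stirlingFirst k 0 : R) = 0 := by
        cases k <;> simp [Nat.stirlingFirst_succ_zero]
      rw [h0] at h1
      simp only [Nat.cast_zero, mul_zero, zero_mul, add_zero] at h1
      rw [← h1, Finset.sum_mul]
      exact Finset.sum_congr rfl fun l _ => by ring
    · rw [Finset.sum_mul]
      exact Finset.sum_congr rfl fun l _ => by ring

/-- The signed Stirling numbers of the first kind are the connecting coefficients in
`x (x + 1) ⋯ (x + k - 1) = (-1)^k ∑_{l = 0}^k (-1)^l S_k^{(1)}(l) x^l`. -/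
theorem ascPochhammer_eval_eq_sum_signedStirlingFirst {R : Type*} [CommRing R]
    (k : ℕ) (x : R) :
    (ascPochhammer R k).eval x =
      (-1) ^ k * ∑ l ∈ Finset.range (k + 1),
        (-1) ^ l * (signedStirlingFirst k l : R) * x ^ l := by
  rw [ascPochhammer_eval_eq_sum_stirlingFirst, Finset.mul_sum]
  refine Finset.sum_congr rfl fun l _ => ?_
  have h : ((-1 : R) ^ k * (-1) ^ l) * ((-1) ^ k * (-1) ^ l) = 1 := by
    rw [← pow_add, ← mul_pow]; simp
  simp only [signedStirlingFirst, Int.cast_mul, Int.cast_pow, Int.cast_neg, Int.cast_one,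
    Int.cast_natCast, pow_add]
  linear_combination (-(Nat.stirlingFirst k l : R) * x ^ l) * h

/-- The numerators
`(-1)^{k+1} ∑_{l=1}^k (-1)^l / (l (l+1) (l+2)) * B_{l+2} * S_k^{(1)}(l)`. -/
def logSumNumer₁ (k : ℕ) : ℚ :=
  (-1) ^ (k + 1) * ∑ l ∈ Finset.Icc 1 k,
    (-1) ^ l / ((l : ℚ) * (l + 1) * (l + 2)) * bernoulli (l + 2) * (signedStirlingFirst k l : ℚ)

/-- The numerators
`(-1)^{k+1} ∑_{l=1}^k (-1)^l / ((l+1) (l+2) (l+3)) * B_{l+3} * S_k^{(1)}(l)`. -/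
def logSumNumer₂ (k : ℕ) : ℚ :=
  (-1) ^ (k + 1) * ∑ l ∈ Finset.Icc 1 k,
    (-1) ^ l / (((l : ℚ) + 1) * (l + 2) * (l + 3)) * bernoulli (l + 3) *
      (signedStirlingFirst k l : ℚ)

/-- The `k`-th term of the first series: `logSumNumer₁ k / ((n+1) (n+2) ⋯ (n+k))`. -/
noncomputable def logSumTerm₁ (n k : ℕ) : ℝ :=
  (logSumNumer₁ k : ℝ) / ∏ j ∈ Finset.Icc 1 k, ((n : ℝ) + j)

/-- The `k`-th term of the second series: `logSumNumer₂ k / (n (n+1) (n+2) ⋯ (n+k))`. -/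
noncomputable def logSumTerm₂ (n k : ℕ) : ℝ :=
  (logSumNumer₂ k : ℝ) / ∏ j ∈ Finset.Icc 0 k, ((n : ℝ) + j)

/-- The elementary part
`n² log n / 2 - n² / 4 + n log n / 2 + log n / 12 + 1 / 12`. -/
noncomputable def logSumMain (n : ℕ) : ℝ :=
  1 / 2 * (n : ℝ) ^ 2 * Real.log n - 1 / 4 * (n : ℝ) ^ 2 + 1 / 2 * (n : ℝ) * Real.log n
    + 1 / 12 * Real.log n + 1 / 12

/-! Write x^(k) for the rising factorial, c_k and d_k for the two numerators, Δ for the forward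
difference, and L for the functional X^l ↦ B_{l+2}/(l(l+1)(l+2)), so that c_k = -L(x^(k)). The
recurrence of the Bernoulli numbers gives L(X ΔF) = -∫₀¹ (B₂(y)/2) F(y) dy
(`bernoulliFunctional_X_mul_forwardDiff`). Since X Δx^(k) = k x^(k), this yields k c_k = ∫₀¹
(B₂(y)/2) y^(k) dy, hence |c_{k+1}| ≤ k! and absolute convergence.

Let R(n) be the first series. The k-th term of R(n) - R(n+1) is k c_k/((n+1)⋯(n+k+1)), and ∑
y^(k)/((n+1)⋯(n+k+1)) telescopes to 1/(n+1-y). So R(n) - R(n+1) = ∫₀¹ (B₂(y)/2)/(n+1-y) dy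
(`tsum_logSumTerm₁_sub`), which is exactly the error made by the elementary part in one step. Thus ∑
k log k minus the elementary part minus R(n) is constant in n, and R(n) → 0 identifies the constant
as a limit.

That limit is -ζ'(-1). Euler–Maclaurin summation writes ζ(s) as an elementary function plus a series
of one-step defects, first for Re s > 1, then by the identity theorem on a ball containing -1
(`riemannZeta_eqOn_zetaBall`); termwise differentiation at -1 gives the claim. The second series is
a summation by parts of the first, because d_k = c_{k+1} - k c_k. -/

open Polynomial in
/-- The linear functional `X ^ l ↦ B_{l+2} / (l (l+1) (l+2))` for `l ≥ 1`, with `1 ↦ 0`. -/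
noncomputable def bernoulliFunctional : ℝ[X] →ₗ[ℝ] ℝ :=
  Polynomial.lsum fun l =>
    ((bernoulli (l + 2) : ℝ) / ((l : ℝ) * (l + 1) * (l + 2))) • LinearMap.id

/-- Half the integral against the second Bernoulli polynomial over `[0, 1]`. -/
noncomputable def bernoulliTwoIntegral (f : ℝ → ℝ) : ℝ :=
  ∫ y in (0 : ℝ)..1, (y ^ 2 - y + 1 / 6) / 2 * f y

/-! ### The Bernoulli functional as an integral against B₂. -/

theorem bernoulliFunctional_C_mul_X_pow (a : ℝ) (l : ℕ) :
    bernoulliFunctional (Polynomial.C a * Polynomial.X ^ l) =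
      (bernoulli (l + 2) : ℝ) / ((l : ℝ) * (l + 1) * (l + 2)) * a := by
  rw [bernoulliFunctional, Polynomial.C_mul_X_pow_eq_monomial, Polynomial.lsum_apply,
    Polynomial.sum_monomial_index] <;> simp

theorem bernoulliTwoIntegral_pow (j : ℕ) :
    bernoulliTwoIntegral (fun y => y ^ j) =
      (1 / ((j : ℝ) + 3) - 1 / (j + 2) + 1 / (6 * (j + 1))) / 2 := by
  have h : ∀ y : ℝ, (y ^ 2 - y + 1 / 6) / 2 * y ^ j =
      y ^ (j + 2) / 2 - y ^ (j + 1) / 2 + y ^ j / 12 := fun y => by ring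
  simp only [bernoulliTwoIntegral, h]
  rw [intervalIntegral.integral_add (Continuous.intervalIntegrable (by fun_prop) _ _)
      (Continuous.intervalIntegrable (by fun_prop) _ _),
    intervalIntegral.integral_sub (Continuous.intervalIntegrable (by fun_prop) _ _)
      (Continuous.intervalIntegrable (by fun_prop) _ _)]
  simp only [intervalIntegral.integral_div, integral_pow]
  push_cast
  simp only [one_pow, ne_eq, Nat.add_eq_zero_iff, OfNat.ofNat_ne_zero, one_ne_zero, and_false,
    not_false_eq_true, zero_pow, sub_zero]
  field_simp
  ring

/-- The recurrence ∑_{i<N} C(N,i) B_i = 0 at N = j+3, with the terms i = 0, 1, 2 moved to the right.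
-/
theorem sum_choose_mul_bernoulli (j : ℕ) :
    ∑ i ∈ Finset.range j, ((j + 3).choose (i + 3) : ℝ) * (bernoulli (i + 3) : ℝ) =
      -(1 - ((j : ℝ) + 3) / 2 + (j + 3) * (j + 2) / 12) := by
  have h := sum_bernoulli (j + 3)
  rw [if_neg (by omega), Finset.sum_range_succ', Finset.sum_range_succ',
    Finset.sum_range_succ'] at h
  have h2 : ((j + 3).choose 2 : ℚ) = (j + 3) * (j + 2) / 2 := by
    rw [Nat.cast_choose_two]; push_cast; ring
  have hb : bernoulli 2 = 1 / 6 := by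
    rw [bernoulli_eq_bernoulli'_of_ne_one (by norm_num), bernoulli'_two]
  simp only [zero_add, Nat.choose_zero_right, Nat.choose_one_right, bernoulli_zero,
    bernoulli_one, hb, h2, Nat.reduceAdd] at h
  have h' : ∑ i ∈ Finset.range j, ((j + 3).choose (i + 3) : ℚ) * bernoulli (i + 3) =
      -(1 - ((j : ℚ) + 3) / 2 + (j + 3) * (j + 2) / 12) := by
    push_cast at h
    linear_combination h
  have h'' := congrArg (fun q : ℚ => (q : ℝ)) h'
  push_cast at h''
  exact h''

/-- After binomial expansion, C(j,i)/((i+1)(i+2)(i+3)) = C(j+3,i+3)/((j+1)(j+2)(j+3)): the three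
factors in the denominator of the functional turn the sum into the Bernoulli recurrence. -/
theorem bernoulliFunctional_X_mul_forwardDiff_X_pow (j : ℕ) :
    bernoulliFunctional (Polynomial.X * ((Polynomial.X + 1) ^ j - Polynomial.X ^ j)) =
      -bernoulliTwoIntegral (fun y => y ^ j) := by
  have h1 : (Polynomial.X * ((Polynomial.X + 1) ^ j - Polynomial.X ^ j) : Polynomial ℝ) =
      ∑ i ∈ Finset.range j, Polynomial.C (j.choose i : ℝ) * Polynomial.X ^ (i + 1) := by
    rw [add_pow, Finset.sum_range_succ]
    simp [Finset.mul_sum]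
    exact Finset.sum_congr rfl fun i _ => by ring
  rw [h1, map_sum, bernoulliTwoIntegral_pow]
  have h2 : ∀ i ∈ Finset.range j,
      bernoulliFunctional (Polynomial.C (j.choose i : ℝ) * Polynomial.X ^ (i + 1)) =
      ((j + 3).choose (i + 3) : ℝ) * (bernoulli (i + 3) : ℝ) / ((j + 1) * (j + 2) * (j + 3)) := by
    intro i _
    rw [bernoulliFunctional_C_mul_X_pow]
    have e1 := Nat.add_one_mul_choose_eq j i
    have e2 := Nat.add_one_mul_choose_eq (j + 1) (i + 1)
    have e3 := Nat.add_one_mul_choose_eq (j + 2) (i + 2)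
    have e1' : ((j : ℝ) + 1) * j.choose i = (j + 1).choose (i + 1) * (i + 1) := by exact_mod_cast e1
    have e2' : ((j : ℝ) + 2) * (j + 1).choose (i + 1) = (j + 2).choose (i + 2) * (i + 2) := by
      exact_mod_cast e2
    have e3' : ((j : ℝ) + 3) * (j + 2).choose (i + 2) = (j + 3).choose (i + 3) * (i + 3) := by
      exact_mod_cast e3
    push_cast
    rw [show (i + 1 + 2) = i + 3 from rfl, div_mul_eq_mul_div,
      div_eq_div_iff (by positivity) (by positivity)]
    linear_combination (bernoulli (i + 3) : ℝ) * ((j + 2) * (j + 3) * e1' + (j + 3) * (i + 1) * e2'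
      + (i + 1) * (i + 2) * e3')
  rw [Finset.sum_congr rfl h2, ← Finset.sum_div, sum_choose_mul_bernoulli]
  field_simp
  ring

theorem bernoulliFunctional_X_mul_forwardDiff (F : Polynomial ℝ) :
    bernoulliFunctional (Polynomial.X * (F.comp (Polynomial.X + 1) - F)) =
      -bernoulliTwoIntegral (fun y => F.eval y) := by
  induction F using Polynomial.induction_on' with
  | add p q hp hq =>
    have h : bernoulliTwoIntegral (fun y => (p + q).eval y) =
        bernoulliTwoIntegral (fun y => p.eval y) + bernoulliTwoIntegral (fun y => q.eval y) := by
      simp only [bernoulliTwoIntegral, Polynomial.eval_add, mul_add]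
      exact intervalIntegral.integral_add
        (Continuous.intervalIntegrable (by fun_prop) _ _)
        (Continuous.intervalIntegrable (by fun_prop) _ _)
    rw [h, neg_add, ← hp, ← hq, ← map_add, Polynomial.add_comp]
    congr 1
    ring
  | monomial j a =>
    have h : bernoulliTwoIntegral (fun y => (Polynomial.monomial j a).eval y) =
        a * bernoulliTwoIntegral (fun y => y ^ j) := by
      simp only [bernoulliTwoIntegral, Polynomial.eval_monomial,
        ← intervalIntegral.integral_const_mul]
      exact intervalIntegral.integral_congr fun y _ => by ring
    rw [h, ← mul_neg, ← bernoulliFunctional_X_mul_forwardDiff_X_pow, ← smul_eq_mul (a := a),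
      ← map_smul,
      Polynomial.monomial_comp, ← Polynomial.C_mul_X_pow_eq_monomial, Polynomial.smul_eq_C_mul]
    congr 1
    ring

/-! ### The numerators as values of the functional on rising factorials. -/

theorem ascPochhammer_eq_sum_stirlingFirst (k : ℕ) :
    ascPochhammer ℝ k =
      ∑ l ∈ Finset.range (k + 1), Polynomial.C (Nat.stirlingFirst k l : ℝ) * Polynomial.X ^ l :=
  Polynomial.funext fun x => by
    rw [ascPochhammer_eval_eq_sum_stirlingFirst, Polynomial.eval_finsetSum]
    simp

theorem neg_one_pow_mul_signedStirlingFirst (k l : ℕ) :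
    (-1 : ℝ) ^ (k + 1) * ((-1) ^ l * (signedStirlingFirst k l : ℝ)) =
      -(Nat.stirlingFirst k l : ℝ) := by
  have h : ((-1 : ℝ) ^ k * (-1) ^ l) * ((-1) ^ k * (-1) ^ l) = 1 := by
    rw [← pow_add, ← mul_pow]; simp
  simp only [signedStirlingFirst, Int.cast_mul, Int.cast_pow, Int.cast_neg, Int.cast_one,
    Int.cast_natCast, pow_add]
  linear_combination -(Nat.stirlingFirst k l : ℝ) * h

theorem logSumNumer₁_eq (k : ℕ) :
    (logSumNumer₁ k : ℝ) = -bernoulliFunctional (ascPochhammer ℝ k) := by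
  -- The term l = 0 is split off; it vanishes because its denominator is 0 and division by 0 gives
  -- 0.
  rw [ascPochhammer_eq_sum_stirlingFirst, map_sum, Finset.sum_range_eq_add_Ico _ (by omega),
    bernoulliFunctional_C_mul_X_pow, logSumNumer₁]
  push_cast
  rw [Finset.mul_sum, ← Finset.Ico_succ_right_eq_Icc]
  simp only [zero_mul, div_zero, zero_add, ← Finset.sum_neg_distrib, Order.succ_eq_add_one]
  refine Finset.sum_congr rfl fun l _ => ?_
  rw [bernoulliFunctional_C_mul_X_pow]
  linear_combination (bernoulli (l + 2) : ℝ) / ((l : ℝ) * (l + 1) * (l + 2)) *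
    neg_one_pow_mul_signedStirlingFirst k l

theorem logSumNumer₂_eq {k : ℕ} (hk : k ≠ 0) :
    (logSumNumer₂ k : ℝ) = -bernoulliFunctional (Polynomial.X * ascPochhammer ℝ k) := by
  rw [ascPochhammer_eq_sum_stirlingFirst, Finset.mul_sum, map_sum,
    Finset.sum_range_eq_add_Ico _ (by omega), logSumNumer₂]
  obtain ⟨m, rfl⟩ := Nat.exists_eq_succ_of_ne_zero hk
  rw [Nat.stirlingFirst_succ_zero]
  push_cast
  rw [Finset.mul_sum, ← Finset.Ico_succ_right_eq_Icc]
  simp only [zero_mul, mul_zero, map_zero, zero_add, ← Finset.sum_neg_distrib,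
    Order.succ_eq_add_one]
  refine Finset.sum_congr rfl fun l _ => ?_
  rw [mul_left_comm Polynomial.X, ← pow_succ', bernoulliFunctional_C_mul_X_pow]
  push_cast
  have h := neg_one_pow_mul_signedStirlingFirst (m + 1) l
  rw [show (l + 1 + 2) = l + 3 from rfl, add_assoc (l : ℝ) 1 1, add_assoc (l : ℝ) 1 2]
  norm_num only [Nat.succ_eq_add_one]
  linear_combination (bernoulli (l + 3) : ℝ) / (((l : ℝ) + 1) * (l + 2) * (l + 3)) * h

/-- The rising factorial is an eigenvector of F ↦ X ΔF with eigenvalue k, which makes the integral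
formula for the functional applicable to it. -/
theorem ascPochhammer_forwardDiff (k : ℕ) :
    Polynomial.X * ((ascPochhammer ℝ k).comp (Polynomial.X + 1) - ascPochhammer ℝ k) =
      (k : ℝ) • ascPochhammer ℝ k := by
  have h1 := ascPochhammer_succ_left ℝ k
  have h2 := ascPochhammer_succ_right ℝ k
  rw [Polynomial.smul_eq_C_mul, mul_sub, ← h1, h2, Polynomial.C_eq_natCast]
  ring

theorem natCast_mul_logSumNumer₁ (k : ℕ) :
    (k : ℝ) * logSumNumer₁ k = bernoulliTwoIntegral fun y => (ascPochhammer ℝ k).eval y := by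
  have h := bernoulliFunctional_X_mul_forwardDiff (ascPochhammer ℝ k)
  rw [ascPochhammer_forwardDiff, map_smul, smul_eq_mul] at h
  rw [logSumNumer₁_eq]
  linarith

theorem natCast_add_one_mul_logSumNumer₂ {k : ℕ} (hk : k ≠ 0) :
    ((k : ℝ) + 1) * logSumNumer₂ k =
      bernoulliTwoIntegral fun y => (y - 1) * (ascPochhammer ℝ k).eval y := by
  -- The factor X - 1 makes this a rising factorial of length k+1 starting at X - 1, whose forward
  -- difference is (k+1) x^(k).
  have h := bernoulliFunctional_X_mul_forwardDiff ((Polynomial.X - 1) * ascPochhammer ℝ k)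
  have e : Polynomial.X * (((Polynomial.X - 1) * ascPochhammer ℝ k).comp (Polynomial.X + 1) -
      (Polynomial.X - 1) * ascPochhammer ℝ k) =
      ((k : ℝ) + 1) • (Polynomial.X * ascPochhammer ℝ k) := by
    have h1 := ascPochhammer_forwardDiff k
    rw [Polynomial.smul_eq_C_mul] at h1 ⊢
    simp only [Polynomial.mul_comp, Polynomial.sub_comp, Polynomial.X_comp, Polynomial.one_comp,
      map_add, map_one]
    linear_combination Polynomial.X * h1
  rw [e, map_smul, smul_eq_mul] at h
  simp only [Polynomial.eval_mul, Polynomial.eval_sub, Polynomial.eval_X,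
    Polynomial.eval_one] at h
  rw [logSumNumer₂_eq hk]
  linarith

/-- Apply the functional to X x^(k) = x^(k+1) - k x^(k). -/
theorem logSumNumer₂_eq_sub {k : ℕ} (hk : k ≠ 0) :
    (logSumNumer₂ k : ℝ) = logSumNumer₁ (k + 1) - k * logSumNumer₁ k := by
  rw [logSumNumer₂_eq hk, logSumNumer₁_eq, logSumNumer₁_eq, ascPochhammer_succ_right, mul_add,
    map_add, mul_comm _ Polynomial.X, mul_comm _ (k : Polynomial ℝ), ← Polynomial.C_eq_natCast,
    ← Polynomial.smul_eq_C_mul, map_smul, smul_eq_mul]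
  ring

/-! ### Bounds and absolute convergence. -/

theorem ascPochhammer_eval_nonneg (k : ℕ) {y : ℝ} (hy : 0 ≤ y) :
    0 ≤ (ascPochhammer ℝ k).eval y := by
  induction k with
  | zero => simp
  | succ k ih => rw [ascPochhammer_succ_eval]; positivity

theorem ascPochhammer_eval_le_factorial (k : ℕ) {y : ℝ} (h0 : 0 ≤ y) (h1 : y ≤ 1) :
    (ascPochhammer ℝ k).eval y ≤ k.factorial := by
  induction k with
  | zero => simp
  | succ k ih =>
    rw [ascPochhammer_succ_eval, Nat.factorial_succ, mul_comm, add_comm y]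
    push_cast
    gcongr
    exact ascPochhammer_eval_nonneg k h0

theorem abs_bernoulliTwoIntegral_le {f : ℝ → ℝ} {C : ℝ}
    (h : ∀ y : ℝ, 0 ≤ y → y ≤ 1 → |f y| ≤ C) : |bernoulliTwoIntegral f| ≤ C := by
  have := intervalIntegral.norm_integral_le_of_norm_le_const (a := 0) (b := 1) (C := C)
    (f := fun y : ℝ => (y ^ 2 - y + 1 / 6) / 2 * f y) fun y hy => by
      rw [Set.uIoc_of_le zero_le_one] at hy
      have h2 : |(y ^ 2 - y + 1 / 6) / 2| ≤ 1 := by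
        rw [abs_le]
        constructor <;> nlinarith [hy.1, hy.2]
      rw [Real.norm_eq_abs, abs_mul]
      have := h y hy.1.le hy.2
      nlinarith [abs_nonneg (f y), abs_nonneg ((y ^ 2 - y + 1 / 6) / 2)]
  simpa [bernoulliTwoIntegral] using this

/-- The integral is at most (k+1)!, and it equals (k+1) c_{k+1}. The factor gained by dividing makes
the terms O(1/k²) even for n = 1. -/
theorem abs_logSumNumer₁_succ_le (k : ℕ) : |(logSumNumer₁ (k + 1) : ℝ)| ≤ k.factorial := by
  have h := abs_bernoulliTwoIntegral_le (C := (k + 1).factorial)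
    (f := fun y => (ascPochhammer ℝ (k + 1)).eval y) fun y h0 h1 => by
      rw [abs_of_nonneg (ascPochhammer_eval_nonneg _ h0)]
      exact ascPochhammer_eval_le_factorial _ h0 h1
  rw [← natCast_mul_logSumNumer₁, abs_mul, Nat.abs_cast, Nat.factorial_succ, Nat.cast_mul] at h
  exact le_of_mul_le_mul_left h (by positivity)

theorem abs_logSumNumer₂_succ_le (k : ℕ) :
    |(logSumNumer₂ (k + 1) : ℝ)| ≤ (k + 1).factorial / ((k : ℝ) + 2) := by
  have h := abs_bernoulliTwoIntegral_le (C := (k + 1).factorial)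
    (f := fun y => (y - 1) * (ascPochhammer ℝ (k + 1)).eval y) fun y h0 h1 => by
      rw [abs_mul, abs_of_nonneg (ascPochhammer_eval_nonneg _ h0)]
      have h2 : |y - 1| ≤ 1 := abs_le.2 ⟨by linarith, by linarith⟩
      exact (mul_le_of_le_one_left (ascPochhammer_eval_nonneg _ h0) h2).trans
        (ascPochhammer_eval_le_factorial _ h0 h1)
  rw [← natCast_add_one_mul_logSumNumer₂ (by omega), abs_mul, abs_of_nonneg (by positivity)] at h
  rw [le_div_iff₀ (by positivity)]
  push_cast at h
  linarith

theorem prod_Icc_one_pos (n k : ℕ) : 0 < ∏ j ∈ Finset.Icc 1 k, ((n : ℝ) + j) :=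
  Finset.prod_pos fun j hj => by
    have : (1 : ℝ) ≤ j := by exact_mod_cast (Finset.mem_Icc.1 hj).1
    positivity

theorem prod_Icc_one_succ (n k : ℕ) :
    ∏ j ∈ Finset.Icc 1 (k + 1), ((n : ℝ) + j) =
      (∏ j ∈ Finset.Icc 1 k, ((n : ℝ) + j)) * (n + k + 1) := by
  rw [Finset.prod_Icc_succ_top (by omega)]
  push_cast
  ring

theorem prod_Icc_one_shift (n k : ℕ) :
    ((n : ℝ) + 1) * ∏ j ∈ Finset.Icc 1 k, (((n + 1 : ℕ) : ℝ) + j) =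
      ∏ j ∈ Finset.Icc 1 (k + 1), ((n : ℝ) + j) := by
  induction k with
  | zero => simp
  | succ k ih =>
    rw [prod_Icc_one_succ, ← mul_assoc, ih, prod_Icc_one_succ _ (k + 1)]
    push_cast
    ring

theorem prod_Icc_zero (n k : ℕ) :
    ∏ j ∈ Finset.Icc 0 k, ((n : ℝ) + j) = n * ∏ j ∈ Finset.Icc 1 k, ((n : ℝ) + j) := by
  rw [← Finset.mul_prod_Ioc_eq_prod_Icc (Nat.zero_le k)]
  simp [← Finset.Icc_succ_left_eq_Ioc]

/-- Since n ≥ 1, the factors after the first dominate 3, 4, …, k+2. The factor n+1 is kept so that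
the bound on the whole series tends to 0 as n grows. -/
theorem factorial_le_prod_Icc_one {n : ℕ} (hn : 1 ≤ n) (k : ℕ) :
    ((n : ℝ) + 1) * (k + 2).factorial / 2 ≤ ∏ j ∈ Finset.Icc 1 (k + 1), ((n : ℝ) + j) := by
  have hn' : (1 : ℝ) ≤ n := by exact_mod_cast hn
  induction k with
  | zero => simp
  | succ k ih =>
    rw [prod_Icc_one_succ, Nat.factorial_succ]
    push_cast
    calc ((n : ℝ) + 1) * ((k + 2 + 1) * (k + 2).factorial) / 2
        = ((n : ℝ) + 1) * (k + 2).factorial / 2 * (1 + (k + 1) + 1) := by ring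
      _ ≤ _ := by gcongr

/-- Telescoping: with q_k = y^(k)/((n+1)⋯(n+k)), the difference q_k - q_{k+1} is (n+1-y) times the
k-th summand. -/
theorem sum_ascPochhammer_div_prod (n K : ℕ) {y : ℝ} (hy : y < n + 1) :
    ∑ k ∈ Finset.range K, (ascPochhammer ℝ k).eval y / ∏ j ∈ Finset.Icc 1 (k + 1), ((n : ℝ) + j) =
      1 / (n + 1 - y) * (1 - (ascPochhammer ℝ K).eval y / ∏ j ∈ Finset.Icc 1 K, ((n : ℝ) + j)) := by
  induction K with
  | zero => simp
  | succ K ih =>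
    have h1 : (n + 1 - y : ℝ) ≠ 0 := by linarith
    have h2 := (prod_Icc_one_pos n K).ne'
    have h3 : (n + K + 1 : ℝ) ≠ 0 := by positivity
    rw [Finset.sum_range_succ, ih, prod_Icc_one_succ, ascPochhammer_succ_eval]
    field_simp
    ring

theorem summable_one_div_add_one_sq : Summable fun k : ℕ => 1 / ((k : ℝ) + 1) ^ 2 := by
  have := (summable_nat_add_iff 1).2 (Real.summable_one_div_nat_pow.2 one_lt_two)
  exact_mod_cast this

theorem abs_logSumTerm₁_le {n : ℕ} (hn : 1 ≤ n) (k : ℕ) :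
    |logSumTerm₁ n (k + 1)| ≤ 2 / ((n : ℝ) + 1) * (1 / ((k : ℝ) + 1) ^ 2) := by
  rw [logSumTerm₁, abs_div, abs_of_pos (prod_Icc_one_pos _ _)]
  calc _ ≤ (k.factorial : ℝ) / (((n : ℝ) + 1) * (k + 2).factorial / 2) := by
        gcongr
        · exact abs_logSumNumer₁_succ_le k
        · exact factorial_le_prod_Icc_one hn k
    _ = 2 / ((n : ℝ) + 1) * (1 / (((k : ℝ) + 1) * (k + 2))) := by
        rw [Nat.factorial_succ, Nat.factorial_succ]
        push_cast
        field_simp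
        ring
    _ ≤ _ := by
        gcongr
        nlinarith [(Nat.cast_nonneg k : (0 : ℝ) ≤ k)]

theorem summable_logSumTerm₁ {n : ℕ} (hn : 1 ≤ n) : Summable fun k => logSumTerm₁ n (k + 1) :=
  .of_norm_bounded (summable_one_div_add_one_sq.mul_left _) (abs_logSumTerm₁_le hn)

theorem tendsto_tsum_logSumTerm₁ :
    Filter.Tendsto (fun n : ℕ => ∑' k, logSumTerm₁ n (k + 1)) Filter.atTop (nhds 0) := by
  have h : Filter.Tendsto (fun n : ℕ => 2 * (1 / ((n : ℝ) + 1)) * ∑' k : ℕ, 1 / ((k : ℝ) + 1) ^ 2)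
      Filter.atTop (nhds 0) := by
    have := ((tendsto_one_div_add_atTop_nhds_zero_nat (𝕜 := ℝ)).const_mul 2).mul_const
      (∑' k : ℕ, 1 / ((k : ℝ) + 1) ^ 2)
    rwa [mul_zero, zero_mul] at this
  refine squeeze_zero_norm' ?_ h
  filter_upwards [Filter.eventually_ge_atTop 1] with n hn
  rw [← mul_div_assoc, mul_one]
  exact tsum_of_norm_bounded (summable_one_div_add_one_sq.hasSum.mul_left _) (abs_logSumTerm₁_le hn)

theorem summable_logSumTerm₂ {n : ℕ} (hn : 1 ≤ n) : Summable fun k => logSumTerm₂ n (k + 1) := by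
  refine .of_norm_bounded summable_one_div_add_one_sq fun k => ?_
  have hn' : (1 : ℝ) ≤ n := by exact_mod_cast hn
  rw [logSumTerm₂, Real.norm_eq_abs, prod_Icc_zero, abs_div,
    abs_of_pos (mul_pos (by linarith) (prod_Icc_one_pos _ _))]
  calc _ ≤ ((k + 1).factorial / ((k : ℝ) + 2)) / (1 * ((1 + 1) * (k + 2).factorial / 2)) := by
        gcongr
        · exact abs_logSumNumer₂_succ_le k
        · refine le_trans ?_ (factorial_le_prod_Icc_one hn k)
          gcongr
    _ = 1 / ((k : ℝ) + 2) ^ 2 := by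
        rw [Nat.factorial_succ (k + 1)]
        push_cast
        field_simp
        ring
    _ ≤ _ := by gcongr; norm_num

theorem logSumTerm₁_sub_logSumTerm₁_succ (n k : ℕ) :
    logSumTerm₁ n k - logSumTerm₁ (n + 1) k =
      k * logSumNumer₁ k / ∏ j ∈ Finset.Icc 1 (k + 1), ((n : ℝ) + j) := by
  have h1 := prod_Icc_one_shift n k
  have h2 := (prod_Icc_one_pos n k).ne'
  have h4 : (n + k + 1 : ℝ) ≠ 0 := by positivity
  have h5 : ∏ j ∈ Finset.Icc 1 k, (((n + 1 : ℕ) : ℝ) + j) =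
      (∏ j ∈ Finset.Icc 1 k, ((n : ℝ) + j)) * (n + k + 1) / (n + 1) := by
    rw [eq_div_iff (by positivity), ← prod_Icc_one_succ, ← h1, mul_comm]
  rw [logSumTerm₁, logSumTerm₁, h5, prod_Icc_one_succ]
  field_simp
  ring

/-! ### Equality of the two series. -/

theorem logSumNumer₁_one : logSumNumer₁ 1 = 0 := by
  have h : bernoulli 3 = 0 := bernoulli_eq_zero_of_odd (by decide) (by norm_num)
  simp [logSumNumer₁, h]

theorem tsum_logSumTerm₂_eq {n : ℕ} (hn : 1 ≤ n) :
    ∑' k, logSumTerm₂ n (k + 1) = ∑' k, logSumTerm₁ n (k + 1) := by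
  have hn' : (1 : ℝ) ≤ n := by exact_mod_cast hn
  have h1 := (summable_logSumTerm₂ hn).hasSum.tendsto_sum_nat
  have h2 := (summable_logSumTerm₁ hn).hasSum.tendsto_sum_nat
  -- Summation by parts from d_k = c_{k+1} - k c_k; the boundary term at K = 0 vanishes because c_1
  -- = 0.
  have hpart : ∀ K, ∑ k ∈ Finset.range K, logSumTerm₂ n (k + 1) =
      ∑ k ∈ Finset.range K, logSumTerm₁ n (k + 1) +
        logSumNumer₁ (K + 1) / (n * ∏ j ∈ Finset.Icc 1 K, ((n : ℝ) + j)) := by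
    intro K
    induction K with
    | zero => simp [logSumNumer₁_one]
    | succ K ih =>
      have h2 := (prod_Icc_one_pos n K).ne'
      have h4 : (n + K + 1 : ℝ) ≠ 0 := by positivity
      rw [Finset.sum_range_succ, ih, Finset.sum_range_succ, logSumTerm₂, logSumTerm₁,
        logSumNumer₂_eq_sub (by omega), prod_Icc_zero, prod_Icc_one_succ]
      push_cast
      field_simp
      ring
  have h3 : Filter.Tendsto (fun K : ℕ =>
      (logSumNumer₁ (K + 1) : ℝ) / (n * ∏ j ∈ Finset.Icc 1 K, ((n : ℝ) + j)))
      Filter.atTop (nhds 0) := by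
    rw [← Filter.tendsto_add_atTop_iff_nat 1]
    refine squeeze_zero_norm (fun K => ?_) tendsto_one_div_add_atTop_nhds_zero_nat
    rw [Real.norm_eq_abs, abs_div, abs_of_pos (mul_pos (by linarith) (prod_Icc_one_pos _ _))]
    calc _ ≤ ((K + 1).factorial : ℝ) / (1 * ((1 + 1) * (K + 2).factorial / 2)) := by
          gcongr
          · exact abs_logSumNumer₁_succ_le _
          · refine le_trans ?_ (factorial_le_prod_Icc_one hn K)
            gcongr
      _ = 1 / ((K : ℝ) + 2) := by
          rw [Nat.factorial_succ (K + 1)]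
          push_cast
          field_simp
          ring
      _ ≤ _ := by gcongr; norm_num
  refine tendsto_nhds_unique h1 ?_
  simp only [hpart]
  simpa using h2.add h3

/-! ### The difference equation in n. -/

theorem bernoulliTwoIntegral_one_div {m : ℝ} (hm : 1 < m) :
    bernoulliTwoIntegral (fun y => 1 / (m - y)) =
      -(2 * m - 1) / 4 + (m ^ 2 - m + 1 / 6) / 2 * (Real.log m - Real.log (m - 1)) := by
  -- With u = m - y, the kernel is y² - y + 1/6 = u² - (2m-1)u + (m² - m + 1/6); divide by u and
  -- integrate.
  have h : ∀ y ∈ Set.uIcc (0 : ℝ) 1, HasDerivAt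
      (fun y => (-(m - y) ^ 2 / 2 + (2 * m - 1) * (m - y) -
        (m ^ 2 - m + 1 / 6) * Real.log (m - y)) / 2)
      ((y ^ 2 - y + 1 / 6) / 2 * (1 / (m - y))) y := by
    intro y hy
    rw [Set.uIcc_of_le zero_le_one] at hy
    have h0 : m - y ≠ 0 := by linarith [hy.2]
    have h1 : HasDerivAt (fun y => m - y) (-1) y := by
      simpa using (hasDerivAt_id y).const_sub m
    refine (((((h1.pow 2).neg.div_const 2).add (h1.const_mul (2 * m - 1))).sub
      ((h1.log h0).const_mul (m ^ 2 - m + 1 / 6))).div_const 2).congr_deriv ?_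
    field_simp
    ring
  rw [bernoulliTwoIntegral, intervalIntegral.integral_eq_sub_of_hasDerivAt h]
  · simp only [sub_zero]
    ring
  · refine ContinuousOn.intervalIntegrable fun y hy => ?_
    rw [Set.uIcc_of_le zero_le_one] at hy
    have h0 : m - y ≠ 0 := by linarith [hy.2]
    exact ContinuousAt.continuousWithinAt (by fun_prop (disch := assumption))

theorem bernoulliTwoIntegral_sum {ι : Type*} (s : Finset ι) {f : ι → ℝ → ℝ}
    (hf : ∀ i ∈ s, Continuous (f i)) :
    bernoulliTwoIntegral (fun y => ∑ i ∈ s, f i y) = ∑ i ∈ s, bernoulliTwoIntegral (f i) := by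
  simp only [bernoulliTwoIntegral, Finset.mul_sum]
  exact intervalIntegral.integral_finsetSum fun i hi =>
    have := hf i hi
    Continuous.intervalIntegrable (by fun_prop) _ _

theorem tsum_logSumTerm₁_sub {n : ℕ} (hn : 1 ≤ n) :
    ∑' k, logSumTerm₁ n (k + 1) - ∑' k, logSumTerm₁ (n + 1) (k + 1) =
      bernoulliTwoIntegral (fun y => 1 / ((n : ℝ) + 1 - y)) := by
  have hn' : (1 : ℝ) ≤ n := by exact_mod_cast hn
  have h1 := ((summable_logSumTerm₁ hn).hasSum.sub
    (summable_logSumTerm₁ (hn.trans n.le_succ)).hasSum).tendsto_sum_nat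
  have hpart : ∀ K, ∑ k ∈ Finset.range K, (logSumTerm₁ n (k + 1) - logSumTerm₁ (n + 1) (k + 1)) =
      bernoulliTwoIntegral (fun y => 1 / ((n : ℝ) + 1 - y) *
        (1 - (ascPochhammer ℝ (K + 1)).eval y / ∏ j ∈ Finset.Icc 1 (K + 1), ((n : ℝ) + j))) := by
    intro K
    -- Adding the index k = 0 on the right is free, its term carrying the factor k; the sum then
    -- starts at y^(0) = 1, as the telescoping needs.
    have h2 : ∑ k ∈ Finset.range K, (logSumTerm₁ n (k + 1) - logSumTerm₁ (n + 1) (k + 1)) =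
        ∑ k ∈ Finset.range (K + 1),
          (k * logSumNumer₁ k / ∏ j ∈ Finset.Icc 1 (k + 1), ((n : ℝ) + j)) := by
      rw [Finset.sum_range_succ']
      simp only [logSumTerm₁_sub_logSumTerm₁_succ]
      simp
    have h3 : ∀ k : ℕ, (k * logSumNumer₁ k / ∏ j ∈ Finset.Icc 1 (k + 1), ((n : ℝ) + j)) =
        bernoulliTwoIntegral fun y =>
          (ascPochhammer ℝ k).eval y / ∏ j ∈ Finset.Icc 1 (k + 1), ((n : ℝ) + j) := by
      intro k
      rw [natCast_mul_logSumNumer₁]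
      simp only [bernoulliTwoIntegral, ← intervalIntegral.integral_div, mul_div_assoc]
    rw [h2]
    simp only [h3]
    rw [← bernoulliTwoIntegral_sum _ fun k _ => by fun_prop]
    refine intervalIntegral.integral_congr fun y hy => ?_
    rw [Set.uIcc_of_le zero_le_one] at hy
    simp only
    rw [sum_ascPochhammer_div_prod n (K + 1) (by linarith [hy.2])]
  have hc : ContinuousOn (fun y : ℝ => 1 / ((n : ℝ) + 1 - y)) (Set.uIcc 0 1) := by
    intro y hy
    rw [Set.uIcc_of_le zero_le_one] at hy
    have h0 : (n : ℝ) + 1 - y ≠ 0 := by linarith [hy.2]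
    exact ContinuousAt.continuousWithinAt (by fun_prop (disch := assumption))
  -- The error integrand is at most 1/(K+2) on [0, 1]: there 1/(n+1-y) ≤ 1, y^(K+1) ≤ (K+1)!, and
  -- the product is at least (K+2)!. No interchange of an infinite sum with the integral is needed.
  have h4 : Filter.Tendsto (fun K : ℕ => bernoulliTwoIntegral (fun y => 1 / ((n : ℝ) + 1 - y) *
        (1 - (ascPochhammer ℝ (K + 1)).eval y / ∏ j ∈ Finset.Icc 1 (K + 1), ((n : ℝ) + j))))
      Filter.atTop (nhds (bernoulliTwoIntegral (fun y => 1 / ((n : ℝ) + 1 - y)))) := by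
    rw [tendsto_iff_norm_sub_tendsto_zero]
    refine squeeze_zero_norm (fun K => ?_) tendsto_one_div_add_atTop_nhds_zero_nat
    rw [norm_norm, Real.norm_eq_abs]
    have h5 : bernoulliTwoIntegral (fun y => 1 / ((n : ℝ) + 1 - y) *
        (1 - (ascPochhammer ℝ (K + 1)).eval y / ∏ j ∈ Finset.Icc 1 (K + 1), ((n : ℝ) + j))) -
        bernoulliTwoIntegral (fun y => 1 / ((n : ℝ) + 1 - y)) =
        bernoulliTwoIntegral (fun y => -(1 / ((n : ℝ) + 1 - y) *
        ((ascPochhammer ℝ (K + 1)).eval y / ∏ j ∈ Finset.Icc 1 (K + 1), ((n : ℝ) + j)))) := by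
      simp only [bernoulliTwoIntegral]
      rw [← intervalIntegral.integral_sub]
      · exact intervalIntegral.integral_congr fun y _ => by ring
      · exact ContinuousOn.intervalIntegrable (by fun_prop)
      · exact ContinuousOn.intervalIntegrable (by fun_prop)
    rw [h5]
    refine abs_bernoulliTwoIntegral_le fun y h0 h1 => ?_
    rw [abs_neg, abs_of_nonneg (mul_nonneg (one_div_nonneg.2 (by linarith))
      (div_nonneg (ascPochhammer_eval_nonneg _ h0) (prod_Icc_one_pos _ _).le))]
    calc _ ≤ 1 / 1 * (((K + 1).factorial : ℝ) / (((1 + 1) * (K + 2).factorial / 2))) := by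
          have h6 : ((1 : ℝ) + 1) * (K + 2).factorial / 2 ≤
              ∏ j ∈ Finset.Icc 1 (K + 1), ((n : ℝ) + j) := by
            refine le_trans ?_ (factorial_le_prod_Icc_one hn K)
            gcongr
          gcongr
          · exact div_nonneg (ascPochhammer_eval_nonneg _ h0) (prod_Icc_one_pos _ _).le
          · linarith
          · exact ascPochhammer_eval_le_factorial _ h0 h1
      _ = 1 / ((K : ℝ) + 2) := by
          rw [Nat.factorial_succ (K + 1)]
          push_cast
          field_simp
          ring
      _ ≤ _ := by gcongr; norm_num
  refine tendsto_nhds_unique h1 ?_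
  simpa only [hpart] using h4

theorem sum_mul_log_sub_const {n : ℕ} (hn : 1 ≤ n) :
    ∑ k ∈ Finset.range (n + 1), (k : ℝ) * Real.log k - logSumMain n - ∑' k, logSumTerm₁ n (k + 1) =
      ∑ k ∈ Finset.range 2, (k : ℝ) * Real.log k - logSumMain 1 -
        ∑' k, logSumTerm₁ 1 (k + 1) := by
  induction n, hn using Nat.le_induction with
  | base => rfl
  | succ n hn ih =>
    have hn' : (1 : ℝ) ≤ n := by exact_mod_cast hn
    have h := tsum_logSumTerm₁_sub hn
    rw [bernoulliTwoIntegral_one_div (by linarith), add_sub_cancel_right] at h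
    rw [← ih, Finset.sum_range_succ _ (n + 1), logSumMain, logSumMain]
    push_cast
    linear_combination h

theorem tendsto_sum_mul_log_sub {c : ℝ} (hc : Filter.Tendsto (fun n : ℕ =>
      ∑ k ∈ Finset.range (n + 1), (k : ℝ) * Real.log k - logSumMain n) Filter.atTop (nhds c))
    {n : ℕ} (hn : 1 ≤ n) :
    ∑ k ∈ Finset.range (n + 1), (k : ℝ) * Real.log k =
      logSumMain n + c + ∑' k, logSumTerm₁ n (k + 1) := by
  have h1 := hc.sub tendsto_tsum_logSumTerm₁
  have h2 := tendsto_nhds_unique h1 (tendsto_const_nhds.congr' (by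
    filter_upwards [Filter.eventually_ge_atTop 1] with m hm
    exact (sum_mul_log_sub_const hm).symm))
  rw [← sum_mul_log_sub_const hn] at h2
  linarith

/-! ### Euler–Maclaurin defects for ∑ k^{-s}. -/

/-- The terms `n^{1-s}/(1-s) + n^{-s}/2 - s n^{-s-1}/12` of the Euler–Maclaurin expansion of
`∑ k^{-s}`. -/
noncomputable def zetaPartialMain (s : ℂ) (n : ℕ) : ℂ :=
  (n : ℂ) ^ (1 - s) / (1 - s) + (n : ℂ) ^ (-s) / 2 - s / 12 * (n : ℂ) ^ (-s - 1)

/-- The defect of `zetaPartialMain` in one step of the summation of `∑ k^{-s}`. -/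
noncomputable def zetaDefect (n : ℕ) (s : ℂ) : ℂ :=
  ((n + 1 : ℕ) : ℂ) ^ (-s) - zetaPartialMain s (n + 1) + zetaPartialMain s n

theorem sum_range_zetaDefect (s : ℂ) (N : ℕ) :
    ∑ m ∈ Finset.range N, zetaDefect (m + 1) s =
      ∑ m ∈ Finset.range N, ((m + 2 : ℕ) : ℂ) ^ (-s) - zetaPartialMain s (N + 1) +
        zetaPartialMain s 1 := by
  induction N with
  | zero => simp
  | succ N ih =>
    rw [Finset.sum_range_succ, ih, Finset.sum_range_succ, zetaDefect]
    ring

theorem hasDerivAt_ofReal_add_cpow {x y : ℝ} (h : 0 < x + y) (a : ℂ) :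
    HasDerivAt (fun t : ℝ => ((x : ℂ) + t) ^ (a + 1)) ((a + 1) * ((x : ℂ) + y) ^ a) y := by
  have h1 : HasDerivAt (fun z : ℂ => (x : ℂ) + z) 1 (y : ℂ) := (hasDerivAt_id _).const_add _
  have h2 : (x : ℂ) + y ∈ Complex.slitPlane := by
    rw [← Complex.ofReal_add]
    exact Complex.ofReal_mem_slitPlane.2 h
  simpa using (h1.cpow_const (c := a + 1) h2).comp_ofReal

/-- Three integrations by parts of x^{-s} on [n, n+1] against B₃, with the mean value inequality in
place of the remainder integral. -/
theorem norm_zetaDefect_le {n : ℕ} (hn : 1 ≤ n) {s : ℂ} (h1 : s ≠ 1) (hre : -3 ≤ s.re) :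
    ‖zetaDefect n s‖ ≤ ‖s * (s + 1) * (s + 2)‖ * (n : ℝ) ^ (-s.re - 3) := by
  have hn' : (1 : ℝ) ≤ n := by exact_mod_cast hn
  have hs : 1 - s ≠ 0 := sub_ne_zero.2 h1.symm
  -- With f(y) = (n+y)^{-s} and F its antiderivative, g = B₃ f'' - B₃' f' + B₃'' f - B₃''' F, so g'
  -- = B₃ f''' and g(1) - g(0) is 6 times the defect. Exponents are written a + 1 to match
  -- `hasDerivAt_ofReal_add_cpow`.
  let g : ℝ → ℂ := fun y =>
    ((y : ℂ) ^ 3 - 3 / 2 * y ^ 2 + y / 2) * (s * (s + 1) * ((n : ℝ) + y : ℂ) ^ (-s - 3 + 1))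
      - 3 * ((y : ℂ) ^ 2 - y + 1 / 6) * (-s * ((n : ℝ) + y : ℂ) ^ (-s - 2 + 1))
      + 6 * ((y : ℂ) - 1 / 2) * ((n : ℝ) + y : ℂ) ^ (-s - 1 + 1)
      - 6 * (((n : ℝ) + y : ℂ) ^ (-s + 1) / (1 - s))
  have hg : ∀ y ∈ Set.Icc (0 : ℝ) 1, HasDerivWithinAt g
      (((y : ℂ) ^ 3 - 3 / 2 * y ^ 2 + y / 2) *
        (-(s * (s + 1) * (s + 2)) * ((n : ℝ) + y : ℂ) ^ (-s - 3))) (Set.Icc 0 1) y := by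
    intro y hy
    have hpos : 0 < (n : ℝ) + y := by linarith [hy.1]
    have hid : HasDerivAt (fun t : ℝ => (t : ℂ)) 1 y := Complex.ofRealCLM.hasDerivAt
    have d3 := ((hasDerivAt_ofReal_add_cpow hpos (-s - 3)).const_mul (s * (s + 1)))
    have d2 := ((hasDerivAt_ofReal_add_cpow hpos (-s - 2)).const_mul (-s))
    have d1 := hasDerivAt_ofReal_add_cpow hpos (-s - 1)
    have d0 := (hasDerivAt_ofReal_add_cpow hpos (-s)).div_const (1 - s)
    have b3 := (((hid.pow 3).sub ((hid.pow 2).const_mul (3 / 2))).add (hid.div_const 2))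
    have b2 := ((((hid.pow 2).sub hid).add_const (1 / 6)).const_mul 3)
    have b1 := (hid.sub_const (1 / 2)).const_mul 6
    refine HasDerivAt.hasDerivWithinAt ?_
    refine ((((b3.mul d3).sub (b2.mul d2)).add (b1.mul d1)).sub (d0.const_mul 6)).congr_deriv ?_
    simp only [Pi.pow_apply, Pi.sub_apply, Pi.add_apply]
    rw [show -s - 3 + 1 = -s - 2 by ring, show -s - 2 + 1 = -s - 1 by ring,
      show -s - 1 + 1 = -s by ring, show -s + 1 = 1 - s by ring]
    field_simp
    ring
  have hbound := norm_image_sub_le_of_norm_deriv_le_segment_01' hg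
    (C := ‖s * (s + 1) * (s + 2)‖ * (n : ℝ) ^ (-s.re - 3)) fun y hy => by
      have hpos : 0 < (n : ℝ) + y := by linarith [hy.1]
      rw [norm_mul, norm_mul, norm_neg, ← Complex.ofReal_add,
        Complex.norm_cpow_eq_rpow_re_of_pos hpos]
      have hB : ‖((y : ℂ) ^ 3 - 3 / 2 * y ^ 2 + y / 2)‖ ≤ 1 := by
        have : ((y : ℂ) ^ 3 - 3 / 2 * y ^ 2 + y / 2) =
            ((y ^ 3 - 3 / 2 * y ^ 2 + y / 2 : ℝ) : ℂ) := by
          push_cast; ring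
        rw [this, Complex.norm_real, Real.norm_eq_abs, abs_le]
        constructor <;> nlinarith [hy.1, hy.2, mul_nonneg hy.1 (sub_nonneg.2 hy.2.le),
          mul_nonneg (mul_nonneg hy.1 hy.1) (sub_nonneg.2 hy.2.le)]
      -- As Re s ≥ -3 the exponent is nonpositive, so the power is largest at y = 0.
      have hP : ((n : ℝ) + y) ^ (-s - 3).re ≤ (n : ℝ) ^ (-s.re - 3) := by
        simp only [Complex.sub_re, Complex.neg_re, Complex.re_ofNat]
        exact Real.rpow_le_rpow_of_nonpos (by linarith) (by linarith [hy.1]) (by linarith)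
      calc _ ≤ 1 * (‖s * (s + 1) * (s + 2)‖ * (n : ℝ) ^ (-s.re - 3)) := by gcongr
        _ = _ := one_mul _
  have heq : zetaDefect n s = (g 1 - g 0) / 6 := by
    simp only [g, zetaDefect, zetaPartialMain]
    rw [show -s - 3 + 1 = -s - 2 by ring, show -s - 2 + 1 = -s - 1 by ring,
      show -s - 1 + 1 = -s by ring, show -s + 1 = 1 - s by ring]
    push_cast
    simp only [add_zero]
    ring
  rw [heq, norm_div]
  have : ‖(6 : ℂ)‖ = 6 := by simp
  rw [this]
  linarith [norm_nonneg (g 1 - g 0)]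

/-! ### Continuation of the defect series to a neighbourhood of -1. -/

/-- A convex neighbourhood of `-1` that avoids `1` and meets the half-plane `1 < re s`. -/
def zetaBall : Set ℂ := Metric.ball (-1 / 10 + 4 / 5 * Complex.I) (13 / 10)

theorem mem_zetaBall {s : ℂ} :
    s ∈ zetaBall ↔ (s.re + 1 / 10) ^ 2 + (s.im - 4 / 5) ^ 2 < (13 / 10) ^ 2 := by
  rw [zetaBall, Metric.mem_ball, Complex.dist_eq, ← sq_lt_sq₀ (norm_nonneg _) (by norm_num),
    Complex.sq_norm, Complex.normSq_apply]
  simp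
  ring_nf

theorem ne_one_of_mem_zetaBall {s : ℂ} (hs : s ∈ zetaBall) : s ≠ 1 := by
  rintro rfl
  rw [mem_zetaBall] at hs
  norm_num at hs

theorem norm_zetaDefect_le_of_mem_zetaBall (m : ℕ) {s : ℂ} (hs : s ∈ zetaBall) :
    ‖zetaDefect (m + 1) s‖ ≤ 60 * (((m + 1 : ℕ) : ℝ) ^ (-(3 / 2) : ℝ)) := by
  have hs1 := ne_one_of_mem_zetaBall hs
  rw [mem_zetaBall] at hs
  -- This gives -Re s - 3 ≤ -3/2, a summable exponent; the constant 60 is 3 · 4 · 5 from the three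
  -- norm bounds below.
  have hre : -(3 / 2) ≤ s.re := by nlinarith [sq_nonneg (s.im - 4 / 5)]
  have hns : ‖s‖ ≤ 3 := by
    rw [← sq_le_sq₀ (norm_nonneg _) (by norm_num), Complex.sq_norm, Complex.normSq_apply]
    nlinarith [sq_nonneg (s.re - 1), sq_nonneg (s.im - 2), sq_nonneg (s.re + 1),
      sq_nonneg (s.im + 1)]
  have hn1 : ‖s + 1‖ ≤ 4 := (norm_add_le _ _).trans (by rw [norm_one]; linarith)
  have hn2 : ‖s + 2‖ ≤ 5 := (norm_add_le _ _).trans (by rw [Complex.norm_ofNat]; linarith)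
  refine (norm_zetaDefect_le (by omega) hs1 (by linarith)).trans ?_
  rw [norm_mul, norm_mul]
  gcongr
  · calc ‖s‖ * ‖s + 1‖ * ‖s + 2‖ ≤ 3 * 4 * 5 := by gcongr
      _ = 60 := by norm_num
  · simp
  · linarith

theorem summable_natCast_add_one_rpow :
    Summable fun m : ℕ => 60 * (((m + 1 : ℕ) : ℝ) ^ (-(3 / 2) : ℝ)) :=
  ((summable_nat_add_iff 1).2 (Real.summable_nat_rpow.2 (by norm_num))).mul_left _

theorem differentiableAt_zetaPartialMain {n : ℕ} (hn : n ≠ 0) {s : ℂ} (hs : s ≠ 1) :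
    DifferentiableAt ℂ (fun s => zetaPartialMain s n) s := by
  have hs : 1 - s ≠ 0 := sub_ne_zero.2 hs.symm
  have hn : (n : ℂ) ≠ 0 := Nat.cast_ne_zero.2 hn
  unfold zetaPartialMain
  fun_prop (disch := first | assumption | exact Or.inl hn)

theorem differentiableAt_zetaDefect {n : ℕ} (hn : n ≠ 0) {s : ℂ} (hs : s ≠ 1) :
    DifferentiableAt ℂ (zetaDefect n) s := by
  have h : ((n + 1 : ℕ) : ℂ) ≠ 0 := Nat.cast_ne_zero.2 n.succ_ne_zero
  exact ((DifferentiableAt.const_cpow (by fun_prop) (Or.inl h)).sub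
    (differentiableAt_zetaPartialMain n.succ_ne_zero hs)).add
    (differentiableAt_zetaPartialMain hn hs)

theorem tendsto_natCast_add_one_cpow {a : ℂ} (ha : a.re < 0) :
    Filter.Tendsto (fun N : ℕ => ((N + 1 : ℕ) : ℂ) ^ a) Filter.atTop (nhds 0) := by
  rw [tendsto_zero_iff_norm_tendsto_zero]
  have h : ∀ N : ℕ, ‖((N + 1 : ℕ) : ℂ) ^ a‖ = ((N + 1 : ℕ) : ℝ) ^ (-(-a.re)) := fun N => by
    rw [Complex.norm_natCast_cpow_of_pos N.succ_pos, neg_neg]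
  simp only [h]
  exact (tendsto_rpow_neg_atTop (neg_pos.2 ha)).comp
    (tendsto_natCast_atTop_atTop.comp (Filter.tendsto_add_atTop_nat 1))

theorem riemannZeta_eq_tsum_zetaDefect_of_one_lt_re {s : ℂ} (hs : 1 < s.re)
    (hU : s ∈ zetaBall) :
    riemannZeta s = 1 - zetaPartialMain s 1 + ∑' m, zetaDefect (m + 1) s := by
  have h1 := (Summable.of_norm_bounded summable_natCast_add_one_rpow
    fun m => norm_zetaDefect_le_of_mem_zetaBall m hU).hasSum.tendsto_sum_nat
  simp only [sum_range_zetaDefect] at h1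
  have hsum : HasSum (fun m : ℕ => ((m + 1 : ℕ) : ℂ) ^ (-s)) (riemannZeta s) := by
    have h2 : Summable fun m : ℕ => ((m + 1 : ℕ) : ℂ) ^ (-s) := by
      simp only [Complex.cpow_neg, ← one_div]
      exact (summable_nat_add_iff 1).2 (Complex.summable_one_div_nat_cpow.2 hs)
    convert h2.hasSum using 1
    rw [zeta_eq_tsum_one_div_nat_add_one_cpow hs]
    simp only [Complex.cpow_neg, one_div]
    push_cast
    rfl
  have h2 := (Filter.tendsto_add_atTop_iff_nat 1).2 hsum.tendsto_sum_nat
  -- Splits off the first term 1^{-s} = 1, since the defects only sum the powers from 2 on.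
  simp only [Finset.sum_range_succ' _ (_ : ℕ)] at h2
  have h3 : Filter.Tendsto (fun N : ℕ => zetaPartialMain s (N + 1)) Filter.atTop (nhds 0) := by
    have t1 := (tendsto_natCast_add_one_cpow (a := 1 - s) (by simpa using hs)).div_const (1 - s)
    have t2 := (tendsto_natCast_add_one_cpow (a := -s) (by simp; linarith)).div_const 2
    have t3 := (tendsto_natCast_add_one_cpow (a := -s - 1) (by simp; linarith)).const_mul (s / 12)
    simpa [zetaPartialMain] using (t1.add t2).sub t3
  have h4 := ((h2.sub h3).add_const (zetaPartialMain s 1)).sub_const 1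
  have h5 := tendsto_nhds_unique h1 (h4.congr fun N => by
    simp only [zero_add, Nat.cast_one, Complex.one_cpow]
    ring)
  rw [h5]
  ring

/-- Identity theorem: both sides are analytic on the connected ball and agree near 11/10 + 4i/5,
where Re s > 1. -/
theorem riemannZeta_eqOn_zetaBall :
    Set.EqOn riemannZeta (fun s => 1 - zetaPartialMain s 1 + ∑' m, zetaDefect (m + 1) s)
      zetaBall := by
  have hopen : IsOpen zetaBall := Metric.isOpen_ball
  have hd : DifferentiableOn ℂ (fun s => ∑' m, zetaDefect (m + 1) s) zetaBall :=
    Complex.differentiableOn_tsum_of_summable_norm summable_natCast_add_one_rpow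
      (fun m s hs => (differentiableAt_zetaDefect m.succ_ne_zero
        (ne_one_of_mem_zetaBall hs)).differentiableWithinAt) hopen
      fun m s hs => norm_zetaDefect_le_of_mem_zetaBall m hs
  have hz : DifferentiableOn ℂ riemannZeta zetaBall := fun s hs =>
    (differentiableAt_riemannZeta (ne_one_of_mem_zetaBall hs)).differentiableWithinAt
  have hM : DifferentiableOn ℂ (fun s => zetaPartialMain s 1) zetaBall := fun s hs =>
    (differentiableAt_zetaPartialMain one_ne_zero
      (ne_one_of_mem_zetaBall hs)).differentiableWithinAt
  have hmem : (11 / 10 + 4 / 5 * Complex.I : ℂ) ∈ zetaBall := by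
    rw [mem_zetaBall]
    norm_num
  refine (hz.analyticOnNhd hopen).eqOn_of_preconnected_of_eventuallyEq
    (((hM.const_sub 1).add hd).analyticOnNhd hopen) (convex_ball _ _).isPreconnected hmem ?_
  filter_upwards [hopen.mem_nhds hmem, (isOpen_lt continuous_const Complex.continuous_re).mem_nhds
    (show (1 : ℝ) < (11 / 10 + 4 / 5 * Complex.I : ℂ).re by norm_num)] with s hs hre
  exact riemannZeta_eq_tsum_zetaDefect_of_one_lt_re hre hs

/-! ### Derivatives at -1 and the value of the constant. -/

theorem hasDerivAt_zetaPartialMain {n : ℕ} (hn : n ≠ 0) :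
    HasDerivAt (fun s => zetaPartialMain s n) (-(logSumMain n : ℂ)) (-1) := by
  have hn' : (n : ℂ) ≠ 0 := Nat.cast_ne_zero.2 hn
  have hid := hasDerivAt_id (-1 : ℂ)
  have d1 := ((hid.const_sub 1).const_cpow (Or.inl hn')).div (hid.const_sub 1) (by norm_num)
  have d2 := (hid.neg.const_cpow (Or.inl hn')).div_const 2
  have d3 := (hid.div_const 12).mul ((hid.neg.sub_const 1).const_cpow (Or.inl hn'))
  -- The logarithms come from differentiating the powers of n, -n²/4 from the factor 1/(1-s), and
  -- the constant 1/12 from the factor s/12.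
  refine ((d1.add d2).sub d3).congr_deriv ?_
  have e : (1 : ℂ) - -1 = (2 : ℕ) := by norm_num
  simp only [id, Pi.neg_apply, neg_neg, sub_self, Complex.cpow_zero, Complex.cpow_one, e,
    Complex.cpow_natCast]
  rw [logSumMain]
  push_cast
  ring

theorem hasDerivAt_zetaDefect {n : ℕ} (hn : n ≠ 0) :
    HasDerivAt (zetaDefect n)
      ((-(((n + 1 : ℕ) : ℝ) * Real.log (n + 1 : ℕ)) + logSumMain (n + 1) - logSumMain n : ℝ) : ℂ)
      (-1) := by
  have h : ((n + 1 : ℕ) : ℂ) ≠ 0 := Nat.cast_ne_zero.2 n.succ_ne_zero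
  refine ((((hasDerivAt_id (-1 : ℂ)).neg.const_cpow (Or.inl h)).sub
    (hasDerivAt_zetaPartialMain n.succ_ne_zero)).add
    (hasDerivAt_zetaPartialMain hn)).congr_deriv ?_
  simp only [id, Pi.neg_apply, neg_neg, Complex.cpow_one, Nat.succ_eq_add_one,
    ← Complex.natCast_log]
  push_cast
  ring

/-- Differentiating the defect series termwise at -1 is allowed by locally uniform convergence; the
partial sums of the derivatives telescope. -/
theorem tendsto_logSumMain_sub_sum :
    Filter.Tendsto (fun N : ℕ => ((logSumMain (N + 1) -
      ∑ k ∈ Finset.range (N + 1 + 1), (k : ℝ) * Real.log k : ℝ) : ℂ)) Filter.atTop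
      (nhds (deriv riemannZeta (-1))) := by
  have hopen : IsOpen zetaBall := Metric.isOpen_ball
  have hmem : (-1 : ℂ) ∈ zetaBall := by
    rw [mem_zetaBall]
    norm_num
  have hdiff : ∀ m : ℕ, DifferentiableOn ℂ (zetaDefect (m + 1)) zetaBall := fun m s hs =>
    (differentiableAt_zetaDefect m.succ_ne_zero (ne_one_of_mem_zetaBall hs)).differentiableWithinAt
  have h1 := (Complex.hasSum_deriv_of_summable_norm summable_natCast_add_one_rpow hdiff hopen
    (fun m s hs => norm_zetaDefect_le_of_mem_zetaBall m hs) hmem).tendsto_sum_nat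
  have hd := Complex.differentiableOn_tsum_of_summable_norm summable_natCast_add_one_rpow hdiff
    hopen (fun m s hs => norm_zetaDefect_le_of_mem_zetaBall m hs)
  have h2 : deriv riemannZeta (-1) =
      (logSumMain 1 : ℂ) + deriv (fun s => ∑' m, zetaDefect (m + 1) s) (-1) := by
    rw [(riemannZeta_eqOn_zetaBall.eventuallyEq_of_mem (hopen.mem_nhds hmem)).deriv_eq]
    refine (((hasDerivAt_zetaPartialMain one_ne_zero).const_sub 1).add
      (hd.differentiableAt (hopen.mem_nhds hmem)).hasDerivAt).deriv.trans ?_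
    rw [neg_neg]
  rw [h2]
  refine (h1.const_add (logSumMain 1 : ℂ)).congr fun N => ?_
  simp only [(hasDerivAt_zetaDefect (Nat.succ_ne_zero _)).deriv]
  rw [← Complex.ofReal_sum, ← Complex.ofReal_add]
  congr 1
  induction N with
  | zero => simp [Finset.sum_range_succ]
  | succ N ih =>
    rw [Finset.sum_range_succ, ← add_assoc, ih, Finset.sum_range_succ _ (N + 1 + 1)]
    ring

theorem sum_mul_log_eq {n : ℕ} (hn : 1 ≤ n) :
    ((∑ k ∈ Finset.range (n + 1), (k : ℝ) * Real.log k : ℝ) : ℂ) =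
      (logSumMain n : ℂ) - deriv riemannZeta (-1) +
        ((∑' k : ℕ, logSumTerm₁ n (k + 1) : ℝ) : ℂ) := by
  have h1 := tendsto_logSumMain_sub_sum
  have him := (Complex.continuous_im.tendsto _).comp h1
  have hre := (Complex.continuous_re.tendsto _).comp h1
  simp only [Function.comp_def, Complex.ofReal_im, Complex.ofReal_re] at him hre
  -- ζ'(-1) is a limit of real numbers, hence real; this lets the real limit theorem be used.
  have him0 : (deriv riemannZeta (-1)).im = 0 := tendsto_nhds_unique him tendsto_const_nhds
  have hζ : deriv riemannZeta (-1) = ((deriv riemannZeta (-1)).re : ℂ) :=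
    Complex.ext (by simp) (by simp [him0])
  have hc : Filter.Tendsto (fun n : ℕ =>
      ∑ k ∈ Finset.range (n + 1), (k : ℝ) * Real.log k - logSumMain n) Filter.atTop
      (nhds (-(deriv riemannZeta (-1)).re)) := by
    rw [← Filter.tendsto_add_atTop_iff_nat 1]
    simpa using hre.neg
  rw [tendsto_sum_mul_log_sub hc hn, hζ, Complex.ofReal_re]
  push_cast
  ring

theorem mainTheorem8 :
    (∀ n : ℕ, 1 ≤ n →
      (Summable (fun k : ℕ => logSumTerm₁ n (k + 1)) ∧
        ((∑ k ∈ Finset.range (n + 1), (k : ℝ) * Real.log k : ℝ) : ℂ) =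
          (logSumMain n : ℂ) - deriv riemannZeta (-1)
            + ((∑' k : ℕ, logSumTerm₁ n (k + 1) : ℝ) : ℂ)) ∧
      (Summable (fun k : ℕ => logSumTerm₂ n (k + 1)) ∧
        ((∑ k ∈ Finset.range (n + 1), (k : ℝ) * Real.log k : ℝ) : ℂ) =
          (logSumMain n : ℂ) - deriv riemannZeta (-1)
            + ((∑' k : ℕ, logSumTerm₂ n (k + 1) : ℝ) : ℂ))) ∧
    (logSumNumer₁ 1 = 0 ∧ logSumNumer₁ 2 = 1 / 720 ∧ logSumNumer₁ 3 = 1 / 240 ∧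
      logSumNumer₁ 4 = 19 / 1260 ∧ logSumNumer₁ 5 = 17 / 252) ∧
    (logSumNumer₂ 1 = 1 / 720 ∧ logSumNumer₂ 2 = 1 / 720 ∧ logSumNumer₂ 3 = 13 / 5040 ∧
      logSumNumer₂ 4 = 1 / 140) := by
  have b3 : bernoulli 3 = 0 := bernoulli_eq_zero_of_odd (by decide) (by norm_num)
  have b5 : bernoulli 5 = 0 := bernoulli_eq_zero_of_odd (by decide) (by norm_num)
  have b7 : bernoulli 7 = 0 := bernoulli_eq_zero_of_odd (by decide) (by norm_num)
  have b2 : bernoulli 2 = 1 / 6 := by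
    rw [bernoulli_eq_bernoulli'_of_ne_one (by norm_num), bernoulli'_two]
  have b4 : bernoulli 4 = -1 / 30 := by
    rw [bernoulli_eq_bernoulli'_of_ne_one (by norm_num), bernoulli'_four]
  have b6 : bernoulli 6 = 1 / 42 := by
    -- The recurrence ∑_{i<7} C(7,i) B_i = 0 determines B₆ from the earlier values.
    have h := sum_bernoulli 7
    norm_num [Finset.sum_range_succ, b2, b3, b4, b5, Nat.choose] at h
    linarith
  refine ⟨fun n hn => ⟨⟨summable_logSumTerm₁ hn, sum_mul_log_eq hn⟩, summable_logSumTerm₂ hn, ?_⟩,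
    ⟨logSumNumer₁_one, ?_, ?_, ?_, ?_⟩, ?_, ?_, ?_, ?_⟩
  · rw [tsum_logSumTerm₂_eq hn]
    exact sum_mul_log_eq hn
  all_goals norm_num [logSumNumer₁, logSumNumer₂, Finset.sum_Icc_succ_top, signedStirlingFirst,
    Nat.stirlingFirst, b3, b4, b5, b6, b7]
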